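/- For complex $\lambda, a$ with $|\lambda|\le 1$, $\lambda\neq 1$ and $\operatorname{Re} a>0$, let $s\mapsto\Phi(\lambda,s,a)$ be the Lerch transcendent: the entire function of $s\in\mathbb C$ that is given for $\operatorname{Re} s>0$ by the convergent series $$\Phi(\lambda,s,a)=\sum_{n=0}^{\infty}\frac{\lambda^n}{(n+a)^s}$$ (principal powers, $0^0=1$) and by analytic continuation elsewhere. Let $\Phi'_s$ denote its derivative with respect to $s$, and let $\psi=\Gamma'/\Gamma$ be the digamma function. **Theorem 3.** Let $\lambda,a,t\in\mathbb C$ with $|\lambda|\le 1$, $\lambda\ne 1$, $\operatorname{Re} a>0$ and $|t|<\operatorname{Re} a$. Then for every integer $p\ge 1$ the series on the left converges and $$\sum_{n=0}^{\infty}\Phi(\lambda,n+1,a)\,\frac{t^{n+p}}{n+p}=\sum_{k=0}^{p-1}\binom{p-1}{k}\bigl[\Phi'_s(\lambda,-k,a-t)+\psi(k+1)\,\Phi(\lambda,-k,a-t)\bigr]t^{p-1-k}-\bigl[\Phi'_s(\lambda,1-p,a)+\psi(p)\,\Phi(\lambda,1-p,a)\bigr]$$ (with $t^0=1$). Moreover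 (the case $p=0$) the function $t\mapsto\Phi(\lambda,1,a-t)$ has the Maclaurin expansion $$\Phi(\lambda,1,a-t)=\sum_{n=0}^{\infty}\Phi(\lambda,n+1,a)\,t^n ,\qquad |t|<\operatorname{Re} a.$$ -/

import Mathlib

open Filter Topology

namespace Lerch

/-- `∑_{n < N} l ^ n / (n + a) ^ s`, the partial sums of the defining series of the
Lerch transcendent (principal branch of the power; `l ^ 0 = 1`, also for `l = 0`). -/
noncomputable def partialSum (l a s : ℂ) (N : ℕ) : ℂ :=
  ∑ n ∈ Finset.range N, l ^ n / ((n : ℂ) + a) ^ s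

/-- `f` is an entire function that extends `s ↦ ∑_{n ≥ 0} l ^ n / (n + a) ^ s`, `0 < Re s`.
The series is summed in its natural order, as it need not converge absolutely when
`‖l‖ = 1` and `Re s ≤ 1`. -/
structure IsContinuation (l a : ℂ) (f : ℂ → ℂ) : Prop where
  entire : Differentiable ℂ f
  series : ∀ s : ℂ, 0 < s.re → Tendsto (partialSum l a s) atTop (𝓝 (f s))

/-- There is at most one such extension. -/
theorem IsContinuation.unique {l a : ℂ} {f g : ℂ → ℂ}
    (hf : IsContinuation l a f) (hg : IsContinuation l a g) : f = g := by
  have hf' : AnalyticOnNhd ℂ f Set.univ := fun z _ => hf.entire.analyticAt z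
  have hg' : AnalyticOnNhd ℂ g Set.univ := fun z _ => hg.entire.analyticAt z
  refine hf'.eq_of_eventuallyEq hg' (z₀ := 1) ?_
  have ho : {s : ℂ | 0 < s.re} ∈ 𝓝 (1 : ℂ) :=
    (isOpen_lt continuous_const Complex.continuous_re).mem_nhds (by simp)
  filter_upwards [ho] with s hs
  exact tendsto_nhds_unique (hf.series s hs) (hg.series s hs)

/-! Existence of the extension, by repeated summation by parts. -/

/-- Iterated forward differences of `x ↦ (x + a) ^ (-s)`. -/
noncomputable def diff (a : ℂ) : ℕ → ℂ → ℝ → ℂ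
  | 0, s, x => ((x : ℂ) + a) ^ (-s)
  | k + 1, s, x => diff a k s (x + 1) - diff a k s x

theorem add_re_pos {a : ℂ} (ha : 0 < a.re) {x : ℝ} (hx : 0 ≤ x) : 0 < ((x : ℂ) + a).re := by
  simp; linarith

theorem add_ne_zero {a : ℂ} (ha : 0 < a.re) {x : ℝ} (hx : 0 ≤ x) : (x : ℂ) + a ≠ 0 := by
  intro h
  have := add_re_pos ha hx
  rw [h] at this
  simp at this

theorem diff_hasDerivAt {a : ℂ} (ha : 0 < a.re) (k : ℕ) (s : ℂ) {x : ℝ} (hx : 0 ≤ x) :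
    HasDerivAt (diff a k s) (-s * diff a k (s + 1) x) x := by
  induction k generalizing x with
  | zero =>
    have h1 : HasDerivAt (fun y : ℝ => (y : ℂ) + a) 1 x :=
      (Complex.ofRealCLM.hasDerivAt (x := x)).add_const a
    have h2 : HasDerivAt (fun z : ℂ => z ^ (-s)) (-s * ((x : ℂ) + a) ^ (-s - 1) * 1)
        ((x : ℂ) + a) :=
      (hasDerivAt_id _).cpow_const (Or.inl (add_re_pos ha hx))
    have h3 := h2.comp x h1
    have e : -s - 1 = -(s + 1) := by ring
    rw [e] at h3
    simpa [diff, Function.comp_def] using h3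
  | succ k ih =>
    have h1 : HasDerivAt (fun y : ℝ => diff a k s (y + 1)) (-s * diff a k (s + 1) (x + 1)) x :=
      HasDerivAt.comp_add_const x 1 (ih (by linarith))
    have h2 := h1.sub (ih hx)
    have e : -s * diff a (k + 1) (s + 1) x
        = -s * diff a k (s + 1) (x + 1) - -s * diff a k (s + 1) x := by
      simp only [diff]; ring
    rw [e]
    exact h2

theorem diff_differentiable {a : ℂ} (ha : 0 < a.re) (k : ℕ) {x : ℝ} (hx : 0 ≤ x) :
    Differentiable ℂ (fun s => diff a k s x) := by
  induction k generalizing x with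
  | zero =>
    intro s
    exact (DifferentiableAt.const_cpow (differentiable_neg s) (Or.inl (add_ne_zero ha hx)))
  | succ k ih => exact (ih (by linarith)).sub (ih hx)

theorem rpow_le_aux {r M p R : ℝ} (hM : 1 ≤ M) (h0 : 0 < r) (h1 : r ≤ M) (h2 : 1 ≤ M * r)
    (hp : |p| ≤ R) : r ^ p ≤ M ^ R := by
  have hM0 : 0 < M := by linarith
  have hle : r ^ p ≤ M ^ |p| := by
    rcases le_or_gt 0 p with h | h
    · rw [abs_of_nonneg h]
      exact Real.rpow_le_rpow h0.le h1 h
    · rw [abs_of_neg h]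
      have : r ^ p = (r⁻¹) ^ (-p) := by
        rw [Real.inv_rpow h0.le, Real.rpow_neg h0.le, inv_inv]
      rw [this]
      refine Real.rpow_le_rpow (inv_nonneg.2 h0.le) ?_ (by linarith)
      rw [inv_le_iff_one_le_mul₀ h0]
      exact h2
  exact hle.trans (Real.rpow_le_rpow_of_exponent_le hM hp)

theorem diff_zero_bound {a : ℂ} (ha : 0 < a.re) (R : ℝ) :
    ∃ C : ℝ, 0 ≤ C ∧ ∀ s : ℂ, ‖s‖ ≤ R → ∀ σ : ℝ, -σ ≤ s.re → ∀ x : ℝ, 0 ≤ x →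
      ‖diff a 0 s x‖ ≤ C * (x + 1) ^ σ := by
  set M : ℝ := ‖a‖ + 1 + 1 / a.re with hM
  have hinv : 0 < 1 / a.re := by positivity
  have hM1 : 1 ≤ M := by have := norm_nonneg a; linarith
  have hMa : 1 ≤ M * a.re := by
    have h1 : 1 / a.re * a.re = 1 := by field_simp
    have : 0 ≤ (‖a‖ + 1) * a.re := by positivity
    rw [hM, add_mul, h1]; linarith
  refine ⟨M ^ R * Real.exp (Real.pi * R), by positivity, fun s hs σ hσ x hx => ?_⟩
  have hx1 : 0 < x + 1 := by linarith
  have hz := add_ne_zero ha hx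
  set z : ℂ := (x : ℂ) + a with hzdef
  have hzre : z.re = x + a.re := by simp [hzdef]
  have hzn : 0 < ‖z‖ := norm_pos_iff.2 hz
  have hup : ‖z‖ ≤ M * (x + 1) := by
    have : ‖z‖ ≤ x + ‖a‖ := by
      refine (norm_add_le _ _).trans ?_
      simp [abs_of_nonneg hx]
    nlinarith [norm_nonneg a]
  have hlow : x + 1 ≤ M * ‖z‖ := by
    have h1 : x + a.re ≤ ‖z‖ := hzre ▸ Complex.re_le_norm z
    nlinarith
  have hr : ‖z‖ = (x + 1) * (‖z‖ / (x + 1)) := by field_simp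
  have hnorm : ‖z‖ ^ (-s).re ≤ (x + 1) ^ σ * M ^ R := by
    rw [hr, Real.mul_rpow hx1.le (by positivity)]
    refine mul_le_mul ?_ ?_ (by positivity) (by positivity)
    · exact Real.rpow_le_rpow_of_exponent_le (by linarith) (by simp; linarith)
    · refine rpow_le_aux hM1 (by positivity) ?_ ?_ ?_
      · rw [div_le_iff₀ hx1]; exact hup
      · rw [← mul_div_assoc, le_div_iff₀ hx1]; linarith
      · simpa using (Complex.abs_re_le_norm s).trans hs
  have harg : (Real.exp (z.arg * (-s).im))⁻¹ ≤ Real.exp (Real.pi * R) := by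
    rw [← Real.exp_neg]
    apply Real.exp_le_exp.2
    have h1 : |z.arg * s.im| ≤ Real.pi * R := by
      rw [abs_mul]
      exact mul_le_mul (Complex.abs_arg_le_pi z) ((Complex.abs_im_le_norm s).trans hs)
        (abs_nonneg _) Real.pi_pos.le
    have h2 := le_abs_self (z.arg * s.im)
    simp only [Complex.neg_im]; linarith
  calc ‖diff a 0 s x‖ = ‖z‖ ^ (-s).re * (Real.exp (z.arg * (-s).im))⁻¹ := by
        simp only [diff]
        rw [Complex.norm_cpow_of_ne_zero hz, div_eq_mul_inv]
    _ ≤ ((x + 1) ^ σ * M ^ R) * Real.exp (Real.pi * R) :=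
        mul_le_mul hnorm harg (by positivity) (by positivity)
    _ = M ^ R * Real.exp (Real.pi * R) * (x + 1) ^ σ := by ring

theorem diff_bound {a : ℂ} (ha : 0 < a.re) (k : ℕ) (R S : ℝ) :
    ∃ C : ℝ, 0 ≤ C ∧ ∀ s : ℂ, ‖s‖ ≤ R → ∀ σ : ℝ, |σ| ≤ S → -σ ≤ s.re → ∀ x : ℝ, 0 ≤ x →
      ‖diff a k s x‖ ≤ C * (x + 1) ^ (σ - k) := by
  induction k generalizing R S with
  | zero =>
    obtain ⟨C, hC, h⟩ := diff_zero_bound ha R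
    exact ⟨C, hC, fun s hs σ _ hσ x hx => by simpa using h s hs σ hσ x hx⟩
  | succ k ih =>
    obtain ⟨C, hC, h⟩ := ih (R + 1) (S + 1)
    have key : ∀ s : ℂ, ‖s‖ ≤ R → ∀ σ : ℝ, |σ| ≤ S → -σ ≤ s.re → ∀ x : ℝ, 0 ≤ x →
        ‖diff a (k + 1) s x‖ ≤
          (|R| * (C * (2 : ℝ) ^ (S + k + 1))) * (x + 1) ^ (σ - (k + 1 : ℕ)) := by
      intro s hs σ hσS hσ x hx
      have hs1 : ‖s + 1‖ ≤ R + 1 := (norm_add_le _ _).trans (by simpa using hs)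
      have hσ1 : |σ - 1| ≤ S + 1 := (abs_sub _ _).trans (by simpa using hσS)
      have hd : ∀ y ∈ Set.Ico x (x + 1), ‖-s * diff a k (s + 1) y‖ ≤
          (|R| * (C * (2 : ℝ) ^ (S + k + 1))) * (x + 1) ^ (σ - (k + 1 : ℕ)) := by
        intro y hy
        have hy0 : 0 ≤ y := hx.trans hy.1
        have hx1 : 0 < x + 1 := by linarith
        have hy1 : 0 < y + 1 := by linarith
        have hb := h (s + 1) hs1 (σ - 1) hσ1 (by simp; linarith) y hy0
        have e1 : σ - 1 - k = σ - (k + 1 : ℕ) := by push_cast; ring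
        rw [e1] at hb
        have hr : y + 1 = (x + 1) * ((y + 1) / (x + 1)) := by field_simp
        have hpow : (y + 1) ^ (σ - (k + 1 : ℕ)) ≤
            (x + 1) ^ (σ - (k + 1 : ℕ)) * (2 : ℝ) ^ (S + k + 1) := by
          rw [hr, Real.mul_rpow hx1.le (by positivity)]
          refine mul_le_mul_of_nonneg_left ?_ (by positivity)
          refine rpow_le_aux (by norm_num) (by positivity) ?_ ?_ ?_
          · rw [div_le_iff₀ hx1]; linarith [hy.2]
          · rw [← mul_div_assoc, le_div_iff₀ hx1]; linarith [hy.1]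
          · refine (abs_sub _ _).trans ?_
            rw [Nat.abs_cast]; push_cast; linarith
        rw [norm_mul, norm_neg]
        have hR : ‖s‖ ≤ |R| := hs.trans (le_abs_self R)
        calc ‖s‖ * ‖diff a k (s + 1) y‖
            ≤ |R| * (C * ((x + 1) ^ (σ - (k + 1 : ℕ)) * (2 : ℝ) ^ (S + k + 1))) :=
              mul_le_mul hR (hb.trans (mul_le_mul_of_nonneg_left hpow hC)) (norm_nonneg _)
                (abs_nonneg _)
          _ = _ := by ring
      have := norm_image_sub_le_of_norm_deriv_le_segment' (a := x) (b := x + 1)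
        (fun y hy => (diff_hasDerivAt ha k s (hx.trans hy.1)).hasDerivWithinAt) hd
        (x + 1) ⟨by linarith, le_rfl⟩
      simpa [diff] using this
    exact ⟨_, by positivity, key⟩

/-- `m`-fold summation by parts of `∑ l ^ n * diff a j s n`. -/
noncomputable def reg (l a : ℂ) : ℕ → ℕ → ℂ → ℂ
  | 0, j, s => ∑' n : ℕ, l ^ n * diff a j s n
  | m + 1, j, s => (diff a j s 0 + l * reg l a m (j + 1) s) / (1 - l)

theorem sum_by_parts (l a s : ℂ) (j N : ℕ) :
    (1 - l) * ∑ n ∈ Finset.range N, l ^ n * diff a j s n =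
      diff a j s 0 - l ^ N * diff a j s N +
        l * ∑ n ∈ Finset.range N, l ^ n * diff a (j + 1) s n := by
  induction N with
  | zero => simp
  | succ N ih =>
    rw [Finset.sum_range_succ, Finset.sum_range_succ, mul_add, ih]
    simp only [diff]
    push_cast
    ring

theorem tendsto_by_parts {l a s L : ℂ} {j : ℕ} (hl : ‖l‖ ≤ 1) (hl1 : l ≠ 1)
    (h0 : Tendsto (fun N : ℕ => diff a j s N) atTop (𝓝 0))
    (h1 : Tendsto (fun N => ∑ n ∈ Finset.range N, l ^ n * diff a (j + 1) s n) atTop (𝓝 L)) :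
    Tendsto (fun N => ∑ n ∈ Finset.range N, l ^ n * diff a j s n) atTop
      (𝓝 ((diff a j s 0 + l * L) / (1 - l))) := by
  have hne : 1 - l ≠ 0 := sub_ne_zero.2 (Ne.symm hl1)
  have h2 : Tendsto (fun N : ℕ => l ^ N * diff a j s N) atTop (𝓝 0) := by
    refine squeeze_zero_norm (fun N => ?_) (tendsto_norm_zero.comp h0)
    rw [norm_mul, norm_pow]
    exact mul_le_of_le_one_left (norm_nonneg _) (pow_le_one₀ (norm_nonneg _) hl)
  have h3 := (((tendsto_const_nhds (x := diff a j s 0)).sub h2).add (h1.const_mul l)).div_const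
    (1 - l)
  rw [sub_zero] at h3
  refine h3.congr fun N => ?_
  rw [← sum_by_parts, mul_div_cancel_left₀ _ hne]

theorem diff_tendsto_zero {a : ℂ} (ha : 0 < a.re) {j : ℕ} {s : ℂ} (h : 0 < s.re + j) :
    Tendsto (fun N : ℕ => diff a j s N) atTop (𝓝 0) := by
  obtain ⟨C, _, hb⟩ := diff_bound ha j ‖s‖ |s.re|
  have h1 : Tendsto (fun N : ℕ => C * ((N : ℝ) + 1) ^ (-s.re - j)) atTop (𝓝 0) := by
    have h2 := (tendsto_rpow_neg_atTop h).comp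
      (tendsto_atTop_add_const_right atTop (1 : ℝ) tendsto_natCast_atTop_atTop)
    have h3 := h2.const_mul C
    rw [mul_zero] at h3
    refine h3.congr fun N => ?_
    simp only [Function.comp]
    congr 2; ring
  refine squeeze_zero_norm (fun N => ?_) h1
  exact hb s le_rfl (-s.re) (by simp) (by simp) N N.cast_nonneg

theorem term_bound {l a : ℂ} (hl : ‖l‖ ≤ 1) (ha : 0 < a.re) {j : ℕ} {R : ℝ}
    (h : R + 2 ≤ j) :
    ∃ u : ℕ → ℝ, Summable u ∧ ∀ (n : ℕ) (s : ℂ), ‖s‖ ≤ R → ‖l ^ n * diff a j s n‖ ≤ u n := by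
  obtain ⟨C, hC, hb⟩ := diff_bound ha j R |R|
  refine ⟨fun n => C * ((n : ℝ) + 1) ^ (-2 : ℝ), Summable.mul_left C ?_, fun n s hs => ?_⟩
  · have := (summable_nat_add_iff 1).2 (Real.summable_nat_rpow.2 (by norm_num : (-2 : ℝ) < -1))
    simpa using this
  · have h1 := hb s hs R le_rfl (by
      have := (abs_le.1 ((Complex.abs_re_le_norm s).trans hs)).1; linarith) n n.cast_nonneg
    rw [norm_mul, norm_pow]
    refine (mul_le_of_le_one_left (norm_nonneg _) (pow_le_one₀ (norm_nonneg _) hl)).trans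
      (h1.trans (mul_le_mul_of_nonneg_left ?_ hC))
    exact Real.rpow_le_rpow_of_exponent_le (by have := n.cast_nonneg (α := ℝ); linarith)
      (by linarith)

theorem tendsto_reg_zero {l a : ℂ} (hl : ‖l‖ ≤ 1) (ha : 0 < a.re) {j : ℕ} {s : ℂ}
    (h : ‖s‖ + 2 ≤ j) :
    Tendsto (fun N => ∑ n ∈ Finset.range N, l ^ n * diff a j s n) atTop
      (𝓝 (reg l a 0 j s)) := by
  obtain ⟨u, hu, hb⟩ := term_bound hl ha h
  exact (Summable.of_norm_bounded hu fun n => hb n s le_rfl).hasSum.tendsto_sum_nat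

theorem tendsto_reg {l a : ℂ} (hl : ‖l‖ ≤ 1) (hl1 : l ≠ 1) (ha : 0 < a.re) (m : ℕ) {j : ℕ}
    {s : ℂ} (hs : 0 < s.re) (h : ‖s‖ + 2 ≤ (j + m : ℕ)) :
    Tendsto (fun N => ∑ n ∈ Finset.range N, l ^ n * diff a j s n) atTop
      (𝓝 (reg l a m j s)) := by
  induction m generalizing j with
  | zero => exact tendsto_reg_zero hl ha (by simpa using h)
  | succ m ih =>
    refine tendsto_by_parts hl hl1 (diff_tendsto_zero ha ?_) (ih ?_)
    · have := j.cast_nonneg (α := ℝ); linarith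
    · have e : j + 1 + m = j + (m + 1) := by omega
      rw [e]; exact h

theorem reg_succ {l a : ℂ} (hl : ‖l‖ ≤ 1) (hl1 : l ≠ 1) (ha : 0 < a.re) (m : ℕ) {j : ℕ}
    {s : ℂ} (h : ‖s‖ + 2 ≤ (j + m : ℕ)) : reg l a (m + 1) j s = reg l a m j s := by
  induction m generalizing j with
  | zero =>
    have h' : ‖s‖ + 2 ≤ j := by simpa using h
    have h1 : ‖s‖ + 2 ≤ (j + 1 : ℕ) := by push_cast; linarith
    have h2 : 0 < s.re + j := by
      have := (abs_le.1 (Complex.abs_re_le_norm s)).1; linarith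
    exact tendsto_nhds_unique
      (tendsto_by_parts hl hl1 (diff_tendsto_zero ha h2) (tendsto_reg_zero hl ha h1))
      (tendsto_reg_zero hl ha h')
  | succ m ih =>
    have e : j + 1 + m = j + (m + 1) := by omega
    have := ih (j := j + 1) (by rw [e]; exact h)
    rw [reg, this, ← reg]

theorem reg_eq {l a : ℂ} (hl : ‖l‖ ≤ 1) (hl1 : l ≠ 1) (ha : 0 < a.re) {k m : ℕ} {s : ℂ}
    (hk : ‖s‖ + 2 ≤ k) (hkm : k ≤ m) : reg l a m 0 s = reg l a k 0 s := by
  induction m, hkm using Nat.le_induction with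
  | base => rfl
  | succ m hm ih =>
    rw [← ih]
    refine reg_succ hl hl1 ha m (hk.trans ?_)
    rw [zero_add]; exact_mod_cast hm

theorem reg_differentiableOn {l a : ℂ} (hl : ‖l‖ ≤ 1) (ha : 0 < a.re) (m : ℕ) {j : ℕ} {R : ℝ}
    (h : R + 2 ≤ (j + m : ℕ)) : DifferentiableOn ℂ (reg l a m j) (Metric.ball 0 R) := by
  induction m generalizing j with
  | zero =>
    obtain ⟨u, hu, hb⟩ := term_bound (l := l) hl ha (j := j) (R := R) (by simpa using h)
    refine Complex.differentiableOn_tsum_of_summable_norm hu (fun n => ?_) Metric.isOpen_ball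
      fun n s hs => hb n s (by simpa using (Metric.mem_ball.1 hs).le)
    exact ((diff_differentiable ha j n.cast_nonneg).const_mul _).differentiableOn
  | succ m ih =>
    have e : j + 1 + m = j + (m + 1) := by omega
    have := ih (j := j + 1) (by rw [e]; exact h)
    exact (((diff_differentiable ha j le_rfl).differentiableOn).add
      (this.const_mul l)).div_const _

/-- The extension exists. -/
theorem exists_isContinuation {l a : ℂ} (hl : ‖l‖ ≤ 1) (hl1 : l ≠ 1) (ha : 0 < a.re) :
    ∃ f : ℂ → ℂ, IsContinuation l a f := by
  refine ⟨fun s => reg l a (⌈‖s‖⌉₊ + 2) 0 s, fun s => ?_, fun s hs => ?_⟩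
  · set R : ℕ := ⌈‖s‖⌉₊ + 1 with hR
    have hsR : ‖s‖ < R := by
      have := Nat.le_ceil ‖s‖
      rw [hR]; push_cast; linarith
    have hmem : Metric.ball (0 : ℂ) R ∈ 𝓝 s :=
      Metric.isOpen_ball.mem_nhds (by simpa using hsR)
    have hd : DifferentiableAt ℂ (reg l a (R + 2) 0) s :=
      (reg_differentiableOn (R := R) hl ha (R + 2) (by push_cast; linarith)).differentiableAt hmem
    refine hd.congr_of_eventuallyEq ?_
    filter_upwards [hmem] with w hw
    have hw' : ‖w‖ < R := by simpa using hw
    refine (reg_eq hl hl1 ha ?_ ?_).symm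
    · have := Nat.le_ceil ‖w‖
      push_cast; linarith
    · have : ⌈‖w‖⌉₊ ≤ R := Nat.ceil_le.2 hw'.le
      omega
  · have h1 := tendsto_reg hl hl1 ha (⌈‖s‖⌉₊ + 2) (j := 0) hs (by
      have := Nat.le_ceil ‖s‖
      push_cast; linarith)
    refine h1.congr fun N => Finset.sum_congr rfl fun n _ => ?_
    simp [diff, Complex.cpow_neg, div_eq_mul_inv]

end Lerch

open Classical in
/-- The Lerch transcendent `Φ(l, s, a)` for `‖l‖ ≤ 1`, `l ≠ 1`, `0 < Re a` and every complex `s`: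
the sum of `l ^ n / (n + a) ^ s` over `n ≥ 0` when `0 < Re s`, continued to an entire
function of `s`. (It is given the value `0` for all other `l`, `a`.) -/
noncomputable def lerchPhi (l s a : ℂ) : ℂ :=
  if h : ‖l‖ ≤ 1 ∧ l ≠ 1 ∧ 0 < a.re then
    Classical.choose (Lerch.exists_isContinuation h.1 h.2.1 h.2.2) s
  else 0

theorem lerchPhi_isContinuation {l a : ℂ} (hl : ‖l‖ ≤ 1) (hl1 : l ≠ 1) (ha : 0 < a.re) :
    Lerch.IsContinuation l a (fun s => lerchPhi l s a) := by
  have h : ‖l‖ ≤ 1 ∧ l ≠ 1 ∧ 0 < a.re := ⟨hl, hl1, ha⟩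
  have e : (fun s => lerchPhi l s a) =
      Classical.choose (Lerch.exists_isContinuation h.1 h.2.1 h.2.2) := by
    funext s
    simp only [lerchPhi, dif_pos h]
  rw [e]
  exact Classical.choose_spec (Lerch.exists_isContinuation h.1 h.2.1 h.2.2)

/-! Everything follows from `∂Φ/∂a = -s Φ(λ, s + 1, a)`. Iterated at `s = 1`, it gives the Taylor
coefficients of `Φ(λ, 1, ·)` at `a`, hence the case `p = 0`. For `p ≥ 1`, multiply that expansion by
`t ^ (p - 1)` and integrate termwise from `0`. It remains to see that the right-hand side vanishes
at `t = 0` and has derivative `t ^ (p - 1) Φ(λ, 1, a - t)`.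

Differentiating the relation in `s` gives `∂Φ'ₛ(s)/∂a = -Φ(s + 1) - s Φ'ₛ(s + 1)`. At `s = -(k + 1)`
the recurrence `ψ(k + 2) = ψ(k + 1) + 1/(k + 1)` absorbs the extra term, so `A_k = Φ'ₛ(-k) + ψ(k +
1) Φ(-k)` satisfies `A_{k+1}' = (k + 1) A_k` and `A_0' = -Φ(1)`. The derivative of the binomial sum
then telescopes (`sum_choose_mul_pow_hasDerivAt`).

The analytic work is to justify the relation where the series diverges (`lerchPhi_hasDerivAt_param`,
via summation by parts) and to interchange the `s`- and `a`-derivatives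
(`hasDerivAt_deriv_of_norm_le`). -/

namespace Lerch

/-! ### The regularized sums as functions of the parameter `a`. -/

theorem diff_hasDerivAt_param {z : ℂ} (hz : 0 < z.re) (k : ℕ) (s : ℂ) {x : ℝ} (hx : 0 ≤ x) :
    HasDerivAt (fun z => diff z k s x) (-s * diff z k (s + 1) x) z := by
  induction k generalizing x with
  | zero =>
    have h1 : HasDerivAt (fun w : ℂ => (x : ℂ) + w) 1 z := (hasDerivAt_id z).const_add _
    have h2 := h1.cpow_const (c := -s) (Or.inl (add_re_pos hz hx))
    have e : -s - 1 = -(s + 1) := by ring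
    rw [e, mul_one] at h2
    exact h2
  | succ k ih =>
    have h2 := (ih (x := x + 1) (by linarith)).sub (ih hx)
    rw [← mul_sub] at h2
    exact h2

theorem diff_zero_bound_uniform {ε : ℝ} (hε : 0 < ε) (B R σ : ℝ) :
    ∃ C : ℝ, 0 ≤ C ∧ ∀ a : ℂ, ε < a.re → ‖a‖ < B → ∀ s : ℂ, ‖s‖ ≤ R → -σ ≤ s.re →
      ∀ x : ℝ, 0 ≤ x → ‖diff a 0 s x‖ ≤ C * (x + 1) ^ σ := by
  -- Chosen so that `(x + 1) / M ≤ ‖x + a‖ ≤ M * (x + 1)` for all admissible `a` at once.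
  set M : ℝ := |B| + 1 + 1 / ε with hM
  have hinv : 0 < 1 / ε := by positivity
  have hB0 := abs_nonneg B
  have hM1 : 1 ≤ M := by linarith
  have hMε : 1 ≤ M * ε := by
    have h1 : 1 / ε * ε = 1 := by field_simp
    have : 0 ≤ (|B| + 1) * ε := by positivity
    rw [hM, add_mul, h1]; linarith
  refine ⟨M ^ R * Real.exp (Real.pi * R), by positivity, fun a ha hB s hs hσ x hx => ?_⟩
  have hx1 : 0 < x + 1 := by linarith
  have hz := add_ne_zero (hε.trans ha) hx
  set z : ℂ := (x : ℂ) + a with hzdef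
  have hzre : z.re = x + a.re := by simp [hzdef]
  have hzn : 0 < ‖z‖ := norm_pos_iff.2 hz
  have hup : ‖z‖ ≤ M * (x + 1) := by
    have : ‖z‖ ≤ x + ‖a‖ := by
      refine (norm_add_le _ _).trans ?_
      simp [abs_of_nonneg hx]
    nlinarith [norm_nonneg a, le_abs_self B]
  have hlow : x + 1 ≤ M * ‖z‖ := by
    have h1 : x + ε ≤ ‖z‖ := by
      have := hzre ▸ Complex.re_le_norm z
      linarith
    nlinarith
  have hr : ‖z‖ = (x + 1) * (‖z‖ / (x + 1)) := by field_simp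
  have hnorm : ‖z‖ ^ (-s).re ≤ (x + 1) ^ σ * M ^ R := by
    rw [hr, Real.mul_rpow hx1.le (by positivity)]
    refine mul_le_mul ?_ ?_ (by positivity) (by positivity)
    · exact Real.rpow_le_rpow_of_exponent_le (by linarith) (by simp; linarith)
    · refine rpow_le_aux hM1 (by positivity) ?_ ?_ ?_
      · rw [div_le_iff₀ hx1]; exact hup
      · rw [← mul_div_assoc, le_div_iff₀ hx1]; linarith
      · simpa using (Complex.abs_re_le_norm s).trans hs
  have harg : (Real.exp (z.arg * (-s).im))⁻¹ ≤ Real.exp (Real.pi * R) := by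
    rw [← Real.exp_neg]
    apply Real.exp_le_exp.2
    have h1 : |z.arg * s.im| ≤ Real.pi * R := by
      rw [abs_mul]
      exact mul_le_mul (Complex.abs_arg_le_pi z) ((Complex.abs_im_le_norm s).trans hs)
        (abs_nonneg _) Real.pi_pos.le
    have h2 := le_abs_self (z.arg * s.im)
    simp only [Complex.neg_im]; linarith
  calc ‖diff a 0 s x‖ = ‖z‖ ^ (-s).re * (Real.exp (z.arg * (-s).im))⁻¹ := by
        simp only [diff]
        rw [Complex.norm_cpow_of_ne_zero hz, div_eq_mul_inv]
    _ ≤ ((x + 1) ^ σ * M ^ R) * Real.exp (Real.pi * R) :=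
        mul_le_mul hnorm harg (by positivity) (by positivity)
    _ = M ^ R * Real.exp (Real.pi * R) * (x + 1) ^ σ := by ring

/-- The bound `diff_bound`, uniformly for `a` in a bounded part of a half-plane. -/
theorem diff_bound_uniform {ε : ℝ} (hε : 0 < ε) (B : ℝ) (k : ℕ) (R σ : ℝ) :
    ∃ C : ℝ, 0 ≤ C ∧ ∀ a : ℂ, ε < a.re → ‖a‖ < B → ∀ s : ℂ, ‖s‖ ≤ R → -σ ≤ s.re →
      ∀ x : ℝ, 0 ≤ x → ‖diff a k s x‖ ≤ C * (x + 1) ^ (σ - k) := by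
  induction k generalizing R σ with
  | zero => simpa using diff_zero_bound_uniform hε B R σ
  | succ k ih =>
    -- By the mean value inequality on `[x, x + 1]`, a difference costs one derivative, which
    -- replaces `s` by `s + 1` and gains one power of decay.
    obtain ⟨C, hC, h⟩ := ih (R + 1) (σ - 1)
    set p : ℝ := σ - (k + 1 : ℕ) with hp
    refine ⟨|R| * (C * (2 : ℝ) ^ |p|), by positivity, fun a ha hB s hs hσ x hx => ?_⟩
    have hs1 : ‖s + 1‖ ≤ R + 1 := (norm_add_le _ _).trans (by simpa using hs)
    have hd : ∀ y ∈ Set.Ico x (x + 1), ‖-s * diff a k (s + 1) y‖ ≤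
        (|R| * (C * (2 : ℝ) ^ |p|)) * (x + 1) ^ p := by
      intro y hy
      have hy0 : 0 ≤ y := hx.trans hy.1
      have hx1 : 0 < x + 1 := by linarith
      have hy1 : 0 < y + 1 := by linarith
      have hb := h a ha hB (s + 1) hs1 (by simp; linarith) y hy0
      have e1 : σ - 1 - k = p := by rw [hp]; push_cast; ring
      rw [e1] at hb
      have hr : y + 1 = (x + 1) * ((y + 1) / (x + 1)) := by field_simp
      -- The ratio `(y + 1) / (x + 1)` lies in `[1, 2]`, and the sign of `p` is unknown.
      have hpow : (y + 1) ^ p ≤ (x + 1) ^ p * (2 : ℝ) ^ |p| := by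
        rw [hr, Real.mul_rpow hx1.le (by positivity)]
        refine mul_le_mul_of_nonneg_left ?_ (by positivity)
        refine rpow_le_aux (by norm_num) (by positivity) ?_ ?_ le_rfl
        · rw [div_le_iff₀ hx1]; linarith [hy.2]
        · rw [← mul_div_assoc, le_div_iff₀ hx1]; linarith [hy.1]
      rw [norm_mul, norm_neg]
      have hR : ‖s‖ ≤ |R| := hs.trans (le_abs_self R)
      calc ‖s‖ * ‖diff a k (s + 1) y‖
          ≤ |R| * (C * ((x + 1) ^ p * (2 : ℝ) ^ |p|)) :=
            mul_le_mul hR (hb.trans (mul_le_mul_of_nonneg_left hpow hC)) (norm_nonneg _)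
              (abs_nonneg _)
        _ = _ := by ring
    have := norm_image_sub_le_of_norm_deriv_le_segment' (a := x) (b := x + 1)
      (fun y hy => (diff_hasDerivAt (hε.trans ha) k s (hx.trans hy.1)).hasDerivWithinAt) hd
      (x + 1) ⟨by linarith, le_rfl⟩
    simpa [diff] using this

theorem term_bound_uniform {l : ℂ} (hl : ‖l‖ ≤ 1) {ε : ℝ} (hε : 0 < ε) (B : ℝ) {j : ℕ} {R : ℝ}
    (h : R + 2 ≤ j) :
    ∃ u : ℕ → ℝ, Summable u ∧ ∀ (n : ℕ) (a s : ℂ), ε < a.re → ‖a‖ < B → ‖s‖ ≤ R →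
      ‖l ^ n * diff a j s n‖ ≤ u n := by
  -- `σ = R` is allowed because `-R ≤ Re s`; the exponent `R - j` is then at most `-2`.
  obtain ⟨C, hC, hb⟩ := diff_bound_uniform hε B j R R
  refine ⟨fun n => C * ((n : ℝ) + 1) ^ (-2 : ℝ), Summable.mul_left C ?_,
    fun n a s ha hB hs => ?_⟩
  · have := (summable_nat_add_iff 1).2 (Real.summable_nat_rpow.2 (by norm_num : (-2 : ℝ) < -1))
    simpa using this
  · have h1 := hb a ha hB s hs (by
      have := (abs_le.1 ((Complex.abs_re_le_norm s).trans hs)).1; linarith) n n.cast_nonneg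
    rw [norm_mul, norm_pow]
    refine (mul_le_of_le_one_left (norm_nonneg _) (pow_le_one₀ (norm_nonneg _) hl)).trans
      (h1.trans (mul_le_mul_of_nonneg_left ?_ hC))
    exact Real.rpow_le_rpow_of_exponent_le (by have := n.cast_nonneg (α := ℝ); linarith)
      (by linarith)

theorem isOpen_halfBall (ε B : ℝ) : IsOpen {z : ℂ | ε < z.re ∧ ‖z‖ < B} :=
  (isOpen_lt continuous_const Complex.continuous_re).inter (isOpen_lt continuous_norm
    continuous_const)

/-- Summation by parts is linear with coefficients free of `z`, so only the absolutely convergent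
series matters. Weierstrass's theorem differentiates it termwise from a majorant at `s` alone; none
is needed at `s + 1`. -/
theorem reg_hasDerivAt_param {l : ℂ} (hl : ‖l‖ ≤ 1) {z : ℂ} (hz : 0 < z.re) (m : ℕ) {j : ℕ}
    {s : ℂ} (h : ‖s‖ + 2 ≤ (j + m : ℕ)) :
    HasDerivAt (fun z => reg l z m j s) (-s * reg l z m j (s + 1)) z := by
  induction m generalizing j with
  | zero =>
    set U : Set ℂ := {w : ℂ | z.re / 2 < w.re ∧ ‖w‖ < ‖z‖ + 1}
    have hU : IsOpen U := isOpen_halfBall _ _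
    have hzU : z ∈ U := ⟨by linarith, by linarith⟩
    obtain ⟨u, hu, hb⟩ := term_bound_uniform hl (half_pos hz) (‖z‖ + 1) (j := j) (R := ‖s‖)
      (by simpa using h)
    have hder : ∀ n : ℕ, ∀ w ∈ U, HasDerivAt (fun w => l ^ n * diff w j s n)
        (l ^ n * (-s * diff w j (s + 1) n)) w := fun n w hw =>
      (diff_hasDerivAt_param ((half_pos hz).trans hw.1) j s n.cast_nonneg).const_mul _
    have hdiff : ∀ n : ℕ, DifferentiableOn ℂ (fun w => l ^ n * diff w j s n) U := fun n w hw =>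
      (hder n w hw).differentiableAt.differentiableWithinAt
    have hbd : ∀ (n : ℕ) (w : ℂ), w ∈ U → ‖l ^ n * diff w j s n‖ ≤ u n := fun n w hw =>
      hb n w s hw.1 hw.2 le_rfl
    have h1 := ((Complex.differentiableOn_tsum_of_summable_norm hu hdiff hU
      hbd).differentiableAt (hU.mem_nhds hzU)).hasDerivAt
    rw [← (Complex.hasSum_deriv_of_summable_norm hu hdiff hU hbd hzU).tsum_eq] at h1
    refine h1.congr_deriv ?_
    simp only [reg]
    rw [← tsum_mul_left]
    refine tsum_congr fun n => ?_
    rw [(hder n z hzU).deriv]; ring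
  | succ m ih =>
    have e : j + 1 + m = j + (m + 1) := by omega
    have h1 := ((diff_hasDerivAt_param hz j s le_rfl).add
      ((ih (j := j + 1) (by rw [e]; exact h)).const_mul l)).div_const (1 - l)
    refine h1.congr_deriv ?_
    simp only [reg]; ring

theorem reg_bound_uniform {l : ℂ} (hl : ‖l‖ ≤ 1) {ε : ℝ} (hε : 0 < ε) (B : ℝ) (m : ℕ) {j : ℕ}
    {R : ℝ} (h : R + 2 ≤ (j + m : ℕ)) :
    ∃ C : ℝ, ∀ a s : ℂ, ε < a.re → ‖a‖ < B → ‖s‖ ≤ R → ‖reg l a m j s‖ ≤ C := by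
  induction m generalizing j with
  | zero =>
    obtain ⟨u, hu, hb⟩ := term_bound_uniform hl hε B (j := j) (R := R) (by simpa using h)
    exact ⟨∑' n, u n, fun a s ha hB hs => tsum_of_norm_bounded hu.hasSum
      fun n => hb n a s ha hB hs⟩
  | succ m ih =>
    have e : j + 1 + m = j + (m + 1) := by omega
    obtain ⟨C, hC⟩ := ih (j := j + 1) (by rw [e]; exact h)
    obtain ⟨D, _, hD⟩ := diff_bound_uniform hε B j R R
    refine ⟨(D + C) / ‖1 - l‖, fun a s ha hB hs => ?_⟩
    rw [reg, norm_div]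
    refine div_le_div_of_nonneg_right ((norm_add_le _ _).trans (add_le_add ?_ ?_)) (norm_nonneg _)
    · simpa using hD a ha hB s hs (by
        have := (abs_le.1 ((Complex.abs_re_le_norm s).trans hs)).1; linarith) 0 le_rfl
    · rw [norm_mul]
      exact (mul_le_of_le_one_left (norm_nonneg _) hl).trans (hC a s ha hB hs)

end Lerch

/-! ### Transfer to the Lerch transcendent. -/

/-- The continuation is chosen separately for each `a`; this formula, with `m` independent of `a`,
is what gives access to regularity in `a`. Both sides are limits of the same partial sums near `s =
1`, which lies in the disc since `1 < R`, so the identity theorem applies. -/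
theorem lerchPhi_eq_reg {l a : ℂ} (hl : ‖l‖ ≤ 1) (hl1 : l ≠ 1) (ha : 0 < a.re) {m : ℕ} {R : ℝ}
    (hR : 1 < R) (hm : R + 2 ≤ m) {s : ℂ} (hs : ‖s‖ < R) :
    lerchPhi l s a = Lerch.reg l a m 0 s := by
  have hc := lerchPhi_isContinuation hl hl1 ha
  have h1 : AnalyticOnNhd ℂ (fun s => lerchPhi l s a) (Metric.ball 0 R) :=
    hc.entire.differentiableOn.analyticOnNhd Metric.isOpen_ball
  have h2 : AnalyticOnNhd ℂ (Lerch.reg l a m 0) (Metric.ball 0 R) :=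
    (Lerch.reg_differentiableOn hl ha m (by simpa using hm)).analyticOnNhd Metric.isOpen_ball
  have h1R : (1 : ℂ) ∈ Metric.ball (0 : ℂ) R := by simpa using hR
  refine h1.eqOn_of_preconnected_of_eventuallyEq h2 (convex_ball _ _).isPreconnected h1R ?_
    (by simpa using hs)
  have ho : {s : ℂ | 0 < s.re} ∈ 𝓝 (1 : ℂ) :=
    (isOpen_lt continuous_const Complex.continuous_re).mem_nhds (by simp)
  filter_upwards [ho, Metric.isOpen_ball.mem_nhds h1R] with w hw hwR
  refine tendsto_nhds_unique (hc.series w hw) ?_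
  have hwR' : ‖w‖ < R := by simpa using hwR
  refine (Lerch.tendsto_reg hl hl1 ha m (j := 0) hw (by simpa using by linarith)).congr
    fun N => Finset.sum_congr rfl fun n _ => ?_
  simp [Lerch.diff, Complex.cpow_neg, div_eq_mul_inv]

theorem lerchPhi_hasDerivAt_param {l : ℂ} (hl : ‖l‖ ≤ 1) (hl1 : l ≠ 1) (s : ℂ) {z : ℂ}
    (hz : 0 < z.re) :
    HasDerivAt (fun z => lerchPhi l s z) (-s * lerchPhi l (s + 1) z) z := by
  -- The disc of radius `‖s‖ + 2` contains `s`, `s + 1` and `1`, so one `m` serves both sides of the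
  -- relation.
  obtain ⟨m, hm⟩ := exists_nat_ge (‖s‖ + 2 + 2)
  have hs1 : ‖s + 1‖ < ‖s‖ + 2 := by
    have := norm_add_le s 1
    rw [norm_one] at this; linarith
  have hs0 := norm_nonneg s
  have h1 := Lerch.reg_hasDerivAt_param hl hz m (j := 0) (s := s) (by rw [zero_add]; linarith)
  rw [lerchPhi_eq_reg hl hl1 hz (by linarith) hm hs1]
  refine h1.congr_of_eventuallyEq ?_
  filter_upwards [(isOpen_lt continuous_const Complex.continuous_re).mem_nhds hz] with w hw
  exact lerchPhi_eq_reg hl hl1 hw (by linarith) hm (by linarith)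

theorem lerchPhi_bound_uniform {l : ℂ} (hl : ‖l‖ ≤ 1) (hl1 : l ≠ 1) {ε : ℝ} (hε : 0 < ε)
    (B R : ℝ) :
    ∃ C : ℝ, ∀ a s : ℂ, ε < a.re → ‖a‖ < B → ‖s‖ ≤ R → ‖lerchPhi l s a‖ ≤ C := by
  have hR0 := le_abs_self R
  have hR1 := abs_nonneg R
  obtain ⟨m, hm⟩ := exists_nat_ge (|R| + 2 + 2)
  obtain ⟨C, hC⟩ := Lerch.reg_bound_uniform hl hε B m (j := 0) (R := R)
    (by rw [zero_add]; linarith)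
  refine ⟨C, fun a s ha hB hs => ?_⟩
  rw [lerchPhi_eq_reg hl hl1 (hε.trans ha) (by linarith) hm (by linarith)]
  exact hC a s ha hB hs

/-! ### Interchange of the derivatives in `s` and `a`. -/

/-- Partial derivatives commute for a locally bounded function of two complex variables that is
holomorphic in each of them. -/
theorem hasDerivAt_deriv_of_norm_le {F G : ℂ → ℂ → ℂ} {U : Set ℂ} (hU : IsOpen U)
    {s₀ z₀ G' : ℂ} {r C : ℝ} (hr : 0 < r) (hz₀ : z₀ ∈ U)
    (hs : ∀ z ∈ U, DifferentiableOn ℂ (fun s => F s z) (Metric.ball s₀ r))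
    (hz : ∀ s ∈ Metric.ball s₀ r, ∀ z ∈ U, HasDerivAt (F s) (G s z) z)
    (hb : ∀ s ∈ Metric.ball s₀ r, ∀ z ∈ U, ‖F s z‖ ≤ C)
    (hG : HasDerivAt (fun s => G s z₀) G' s₀) :
    HasDerivAt (fun z => deriv (fun s => F s z) s₀) G' z₀ := by
  -- The difference quotients in `s` converge uniformly in `z` to the `s`-derivative, so their
  -- `z`-derivatives converge too; at `z₀` these are difference quotients of `G`.
  set D : ℂ → ℂ → ℂ := fun s z => (s - s₀)⁻¹ * (F s z - F s₀ z) with hD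
  have hs₀ : s₀ ∈ Metric.ball s₀ r := Metric.mem_ball_self hr
  have hev : ∀ᶠ s in 𝓝[≠] s₀, s ∈ Metric.ball s₀ r ∧ s ≠ s₀ :=
    (eventually_nhdsWithin_of_eventually_nhds (Metric.ball_mem_nhds s₀ hr)).and
      self_mem_nhdsWithin
  set K : ℝ := 2 * (2 * C / r) / r with hK
  -- The Schwarz lemma is used twice: it bounds the slope function by `2 * C / r`, then makes that
  -- function Lipschitz at `s₀` with constant `K`.
  have hbound : ∀ s ∈ Metric.ball s₀ r, s ≠ s₀ → ∀ z ∈ U,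
      dist (deriv (fun s => F s z) s₀) (D s z) ≤ K * dist s s₀ := by
    intro s hsb hne z hzU
    set f : ℂ → ℂ := fun s => F s z
    have hf : DifferentiableOn ℂ f (Metric.ball s₀ r) := hs z hzU
    have h1 : ∀ w ∈ Metric.ball s₀ r, ‖dslope f s₀ w‖ ≤ 2 * C / r := fun w hw => by
      refine Complex.norm_dslope_le_div_of_mapsTo_ball hf (fun v hv => ?_) hw
      rw [mem_closedBall_iff_norm]
      have := norm_sub_le (f v) (f s₀)
      linarith [hb v hv z hzU, hb s₀ hs₀ z hzU]
    have h2 : DifferentiableOn ℂ (dslope f s₀) (Metric.ball s₀ r) :=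
      (Complex.differentiableOn_dslope (Metric.ball_mem_nhds s₀ hr)).2 hf
    have h3 := Complex.dist_le_div_mul_dist_of_mapsTo_ball (R₂ := 2 * (2 * C / r)) h2
      (fun v hv => by
        rw [mem_closedBall_iff_norm]
        have := norm_sub_le (dslope f s₀ v) (dslope f s₀ s₀)
        linarith [h1 v hv, h1 s₀ hs₀]) hsb
    rw [dslope_same, dslope_of_ne _ hne, slope_def_module, smul_eq_mul, dist_comm] at h3
    exact h3
  have hunif : TendstoUniformlyOn D (fun z => deriv (fun s => F s z) s₀) (𝓝[≠] s₀) U := by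
    rw [Metric.tendstoUniformlyOn_iff]
    intro ε hε
    have ht : Tendsto (fun s => K * dist s s₀) (𝓝[≠] s₀) (𝓝 0) := by
      have : Continuous fun s => K * dist s s₀ := by fun_prop
      have h := this.tendsto s₀
      rw [dist_self, mul_zero] at h
      exact h.mono_left nhdsWithin_le_nhds
    filter_upwards [hev, ht.eventually_lt_const hε] with s h1 h2 z hzU
    exact (hbound s h1.1 h1.2 z hzU).trans_lt h2
  have hDd : ∀ s ∈ Metric.ball s₀ r, ∀ z ∈ U,
      HasDerivAt (D s) ((s - s₀)⁻¹ * (G s z - G s₀ z)) z := fun s hsb z hzU =>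
    ((hz s hsb z hzU).sub (hz s₀ hs₀ z hzU)).const_mul _
  have hDdiff : ∀ᶠ s in 𝓝[≠] s₀, DifferentiableOn ℂ (D s) U := hev.mono fun s h z hzU =>
    (hDd s h.1 z hzU).differentiableAt.differentiableWithinAt
  have hloc := hunif.tendstoLocallyUniformlyOn
  have h1 := ((hloc.differentiableOn hDdiff hU).differentiableAt (hU.mem_nhds hz₀)).hasDerivAt
  have h2 := (hloc.deriv hDdiff hU).tendsto_at hz₀
  have h3 : Tendsto (fun s => (deriv ∘ D) s z₀) (𝓝[≠] s₀) (𝓝 G') := by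
    refine (hasDerivAt_iff_tendsto_slope.1 hG).congr' ?_
    filter_upwards [hev] with s h
    rw [Function.comp, (hDd s h.1 z₀ hz₀).deriv, slope_def_module, smul_eq_mul]
  rwa [tendsto_nhds_unique h2 h3] at h1

theorem lerchPhi_hasDerivAt_deriv {l : ℂ} (hl : ‖l‖ ≤ 1) (hl1 : l ≠ 1) (s : ℂ) {z : ℂ}
    (hz : 0 < z.re) :
    HasDerivAt (fun z => deriv (fun s => lerchPhi l s z) s)
      (-lerchPhi l (s + 1) z - s * deriv (fun s => lerchPhi l s z) (s + 1)) z := by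
  obtain ⟨C, hC⟩ := lerchPhi_bound_uniform hl hl1 (half_pos hz) (‖z‖ + 1) (‖s‖ + 1)
  refine hasDerivAt_deriv_of_norm_le (F := fun s z => lerchPhi l s z)
    (G := fun s z => -s * lerchPhi l (s + 1) z) (C := C)
    (Lerch.isOpen_halfBall (z.re / 2) (‖z‖ + 1)) one_pos ⟨by linarith, by linarith⟩
    (fun w hw => ?_) (fun σ _ w hw => ?_) (fun σ hσ w hw => ?_) ?_
  · exact (lerchPhi_isContinuation hl hl1 ((half_pos hz).trans hw.1)).entire.differentiableOn
  · exact lerchPhi_hasDerivAt_param hl hl1 σ ((half_pos hz).trans hw.1)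
  · refine hC w σ hw.1 hw.2 ?_
    rw [mem_ball_iff_norm] at hσ
    have := norm_add_le (σ - s) s
    rw [sub_add_cancel] at this
    linarith
  · have h1 := (((lerchPhi_isContinuation hl hl1 hz).entire (s + 1)).hasDerivAt).comp_add_const s 1
    refine ((hasDerivAt_id s).neg.mul h1).congr_deriv ?_
    simp only [Pi.neg_apply, id]; ring

/-! ### The Maclaurin expansion. -/

theorem iteratedDeriv_lerchPhi_one {l : ℂ} (hl : ‖l‖ ≤ 1) (hl1 : l ≠ 1) (n : ℕ) {z : ℂ}
    (hz : 0 < z.re) :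
    iteratedDeriv n (fun z => lerchPhi l 1 z) z
      = (-1) ^ n * (n.factorial : ℂ) * lerchPhi l ((n : ℂ) + 1) z := by
  induction n generalizing z with
  | zero => simp
  | succ n ih =>
    rw [iteratedDeriv_succ]
    have hev : iteratedDeriv n (fun z => lerchPhi l 1 z) =ᶠ[𝓝 z]
        fun z => (-1) ^ n * (n.factorial : ℂ) * lerchPhi l ((n : ℂ) + 1) z := by
      filter_upwards [(isOpen_lt continuous_const Complex.continuous_re).mem_nhds hz] with w hw
      exact ih hw
    rw [hev.deriv_eq,
      ((lerchPhi_hasDerivAt_param hl hl1 ((n : ℂ) + 1) hz).const_mul _).deriv, Nat.factorial_succ]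
    push_cast; ring

theorem re_sub_pos {a t : ℂ} (ht : ‖t‖ < a.re) : 0 < (a - t).re := by
  have := Complex.re_le_norm t
  rw [Complex.sub_re]; linarith

/-- This is the Taylor series at `a`, evaluated at `a - t`: the disc of radius `Re a` about `a`
stays in the right half-plane, and the signs of the derivatives cancel those of `(-t) ^ n`. -/
theorem hasSum_lerchPhi_one_sub {l a t : ℂ} (hl : ‖l‖ ≤ 1) (hl1 : l ≠ 1) (ht : ‖t‖ < a.re) :
    HasSum (fun n : ℕ => lerchPhi l ((n : ℂ) + 1) a * t ^ n) (lerchPhi l 1 (a - t)) := by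
  have ha : 0 < a.re := (norm_nonneg t).trans_lt ht
  have hd : DifferentiableOn ℂ (fun z => lerchPhi l 1 z) (Metric.ball a a.re) := by
    intro z hz
    rw [mem_ball_iff_norm'] at hz
    have hz' := re_sub_pos hz
    rw [sub_sub_cancel] at hz'
    exact (lerchPhi_hasDerivAt_param hl hl1 1 hz').differentiableAt.differentiableWithinAt
  have h := Complex.hasSum_taylorSeries_on_ball hd (z := a - t) (by simpa using ht)
  refine h.congr_fun fun n => ?_
  have hn : (n.factorial : ℂ) ≠ 0 := by exact_mod_cast n.factorial_ne_zero
  have h1 : (-1 : ℂ) ^ n * (-1) ^ n = 1 := by rw [← mul_pow]; simp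
  rw [iteratedDeriv_lerchPhi_one hl hl1 n ha, sub_sub_cancel_left, neg_pow t n]
  simp only [smul_eq_mul]
  field_simp
  linear_combination -lerchPhi l (n + 1) a * t ^ n * h1

/-! ### The chain of antiderivatives and the binomial sum. -/

/-- `Φ'ₛ(l, -k, z) + ψ(k + 1) Φ(l, -k, z)`. -/
noncomputable def lerchPhiDigamma (l : ℂ) (k : ℕ) (z : ℂ) : ℂ :=
  deriv (fun s : ℂ => lerchPhi l s z) (-(k : ℂ)) +
    Complex.digamma ((k : ℂ) + 1) * lerchPhi l (-(k : ℂ)) z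

/-- At `s = 0` the factor `-s` kills everything except the term from differentiating that factor
itself. -/
theorem lerchPhiDigamma_zero_hasDerivAt {l : ℂ} (hl : ‖l‖ ≤ 1) (hl1 : l ≠ 1) {z : ℂ}
    (hz : 0 < z.re) : HasDerivAt (lerchPhiDigamma l 0) (-lerchPhi l 1 z) z := by
  have h := (lerchPhi_hasDerivAt_deriv hl hl1 (-((0 : ℕ) : ℂ)) hz).add
    ((lerchPhi_hasDerivAt_param hl hl1 (-((0 : ℕ) : ℂ)) hz).const_mul
      (Complex.digamma (((0 : ℕ) : ℂ) + 1)))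
  refine h.congr_deriv ?_
  simp

theorem lerchPhiDigamma_succ_hasDerivAt {l : ℂ} (hl : ‖l‖ ≤ 1) (hl1 : l ≠ 1) (k : ℕ) {z : ℂ}
    (hz : 0 < z.re) :
    HasDerivAt (lerchPhiDigamma l (k + 1)) (((k : ℂ) + 1) * lerchPhiDigamma l k z) z := by
  have h := (lerchPhi_hasDerivAt_deriv hl hl1 (-((k + 1 : ℕ) : ℂ)) hz).add
    ((lerchPhi_hasDerivAt_param hl hl1 (-((k + 1 : ℕ) : ℂ)) hz).const_mul
      (Complex.digamma (((k + 1 : ℕ) : ℂ) + 1)))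
  refine h.congr_deriv ?_
  have hk : (k : ℂ) + 1 ≠ 0 := Nat.cast_add_one_ne_zero k
  have hψ : Complex.digamma ((k : ℂ) + 1 + 1) = Complex.digamma ((k : ℂ) + 1) + ((k : ℂ) + 1)⁻¹ :=
    Complex.digamma_apply_add_one _ fun m h => by
      have : ((k + 1 + m : ℕ) : ℂ) = 0 := by push_cast; rw [h]; ring
      have := Nat.cast_eq_zero.1 this
      omega
  have e : -((k + 1 : ℕ) : ℂ) + 1 = -(k : ℂ) := by push_cast; ring
  rw [e]
  push_cast
  rw [hψ, lerchPhiDigamma]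
  field_simp
  ring

/-- Telescoping by `(k + 1) * choose q (k + 1) = (q - k) * choose q k`: differentiating `h (k + 1)`
cancels differentiating the power of `t` that accompanies `h k`. -/
theorem sum_choose_mul_pow_hasDerivAt {𝕜 : Type*} [NontriviallyNormedField 𝕜] {h : ℕ → 𝕜 → 𝕜}
    {c t : 𝕜} (h0 : HasDerivAt (h 0) c t)
    (hs : ∀ k : ℕ, HasDerivAt (h (k + 1)) (-((k : 𝕜) + 1) * h k t) t) (q : ℕ) :
    HasDerivAt (fun t => ∑ k ∈ Finset.range (q + 1), (q.choose k : 𝕜) * h k t * t ^ (q - k))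
      (c * t ^ q) t := by
  set h' : ℕ → 𝕜 := fun k => k.casesOn c fun k => -((k : 𝕜) + 1) * h k t
  have hd : ∀ k, HasDerivAt (h k) (h' k) t := fun k => by
    cases k with
    | zero => exact h0
    | succ k => exact hs k
  have h1 := HasDerivAt.fun_sum (u := Finset.range (q + 1)) fun k _ =>
    ((hd k).const_mul (q.choose k : 𝕜)).mul (hasDerivAt_pow (q - k) t)
  refine h1.congr_deriv ?_
  -- The first sum loses `k = 0`, the surviving `c * t ^ q`; the second loses `k = q`, where the
  -- power of `t` is constant.
  rw [Finset.sum_add_distrib, Finset.sum_range_succ', Finset.sum_range_succ _ q]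
  have h2 : ∀ k ∈ Finset.range q, (q.choose (k + 1) : 𝕜) * h' (k + 1) * t ^ (q - (k + 1)) +
      (q.choose k : 𝕜) * h k t * (((q - k : ℕ) : 𝕜) * t ^ (q - k - 1)) = 0 := fun k _ => by
    have e : (q.choose (k + 1) : 𝕜) * ((k : 𝕜) + 1) = q.choose k * ((q - k : ℕ) : 𝕜) := by
      exact_mod_cast congrArg (Nat.cast (R := 𝕜)) (Nat.choose_succ_right_eq q k)
    have e2 : q - (k + 1) = q - k - 1 := by omega
    rw [e2]
    simp only [h']
    linear_combination (-h k t * t ^ (q - k - 1)) * e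
  have h3 := Finset.sum_eq_zero h2
  rw [Finset.sum_add_distrib] at h3
  simp only [h'] at h3 ⊢
  simp only [Nat.sub_self, Nat.cast_zero, Nat.choose_zero_right, Nat.cast_one, Nat.sub_zero]
  linear_combination h3

/-! ### Termwise integration and conclusion. -/

/-- Termwise integration of a power series from `0`, after multiplication by `t ^ q`. -/
theorem hasSum_mul_pow_div_of_hasDerivAt {c : ℕ → ℂ} {f R : ℂ → ℂ} {ρ : ℝ} {q : ℕ}
    (hf : ∀ t : ℂ, ‖t‖ < ρ → HasSum (fun n => c n * t ^ n) (f t))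
    (hR : ∀ t : ℂ, ‖t‖ < ρ → HasDerivAt R (f t * t ^ q) t) (hR0 : R 0 = 0)
    {t : ℂ} (ht : ‖t‖ < ρ) :
    HasSum (fun n : ℕ => c n * (t ^ (n + (q + 1)) / ((n : ℂ) + ((q + 1 : ℕ) : ℂ)))) (R t) := by
  obtain ⟨r, htr, hrρ⟩ := exists_between ht
  have hr : 0 < r := (norm_nonneg t).trans_lt htr
  set F : ℕ → ℂ → ℂ := fun n t => c n * (t ^ (n + (q + 1)) / ((n : ℂ) + ((q + 1 : ℕ) : ℂ)))
  have hne : ∀ n : ℕ, (n : ℂ) + ((q + 1 : ℕ) : ℂ) ≠ 0 := fun n => by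
    rw [← Nat.cast_add, Nat.cast_ne_zero]; omega
  have hF : ∀ n w, HasDerivAt (F n) (c n * w ^ n * w ^ q) w := fun n w => by
    refine (((hasDerivAt_pow (n + (q + 1)) w).div_const _).const_mul (c n)).congr_deriv ?_
    rw [Nat.cast_add, mul_div_assoc, mul_comm, mul_assoc, mul_assoc, mul_comm,
      mul_assoc]
    have := hne n
    have e : n + (q + 1) - 1 = n + q := by omega
    rw [e, pow_add]
    field_simp
  -- The power series converges absolutely at `r`, and the denominators `n + q + 1` have norm at
  -- least `1`.
  have hu : Summable fun n => ‖c n * (r : ℂ) ^ n‖ * r ^ (q + 1) :=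
    ((hf r (by simpa [abs_of_pos hr] using hrρ)).summable.norm).mul_right _
  have hb : ∀ n, ∀ w ∈ Metric.ball (0 : ℂ) r, ‖F n w‖ ≤ ‖c n * (r : ℂ) ^ n‖ * r ^ (q + 1) := by
    intro n w hw
    have hw' : ‖w‖ ≤ r := (mem_ball_zero_iff.1 hw).le
    have h1 : 1 ≤ ‖(n : ℂ) + ((q + 1 : ℕ) : ℂ)‖ := by
      rw [← Nat.cast_add, Complex.norm_natCast]
      exact_mod_cast (by omega : 1 ≤ n + (q + 1))
    rw [norm_mul, norm_mul, norm_div, norm_pow, norm_pow, Complex.norm_real, Real.norm_eq_abs,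
      abs_of_pos hr, mul_assoc, ← pow_add]
    refine mul_le_mul_of_nonneg_left ?_ (norm_nonneg _)
    exact (div_le_self (by positivity) h1).trans (pow_le_pow_left₀ (norm_nonneg _) hw' _)
  have hFd : ∀ n, DifferentiableOn ℂ (F n) (Metric.ball 0 r) := fun n w _ =>
    (hF n w).differentiableAt.differentiableWithinAt
  have hmem : ∀ w ∈ Metric.ball (0 : ℂ) r, ‖w‖ < ρ := fun w hw =>
    (mem_ball_zero_iff.1 hw).trans hrρ
  have hSd := Complex.differentiableOn_tsum_of_summable_norm hu hFd Metric.isOpen_ball hb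
  -- Both functions have derivative `f w * w ^ q` and vanish at `0`, every exponent `n + (q + 1)`
  -- being positive.
  have heq := Metric.isOpen_ball.eqOn_of_deriv_eq (convex_ball (0 : ℂ) r).isPreconnected hSd
    (g := R) (fun w hw => (hR w (hmem w hw)).differentiableAt.differentiableWithinAt)
    (fun w hw => by
      rw [(hR w (hmem w hw)).deriv,
        ← (Complex.hasSum_deriv_of_summable_norm hu hFd Metric.isOpen_ball hb hw).tsum_eq,
        ← ((hf w (hmem w hw)).mul_right _).tsum_eq]
      exact tsum_congr fun n => (hF n w).deriv)
    (Metric.mem_ball_self hr) (by simp [F, hR0])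
  have htb : t ∈ Metric.ball (0 : ℂ) r := by simpa using htr
  rw [← heq htb]
  exact (Summable.of_norm_bounded hu fun n => hb n t htb).hasSum

theorem theorem3 (l a t : ℂ) (hl : ‖l‖ ≤ 1) (hl1 : l ≠ 1) (ha : 0 < a.re) (ht : ‖t‖ < a.re) :
    (∀ p : ℕ, 1 ≤ p →
      HasSum (fun n : ℕ => lerchPhi l ((n : ℂ) + 1) a * (t ^ (n + p) / ((n : ℂ) + (p : ℂ))))
        ((∑ k ∈ Finset.range p, ((p - 1).choose k : ℂ) *
            (deriv (fun s : ℂ => lerchPhi l s (a - t)) (-(k : ℂ)) +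
              Complex.digamma ((k : ℂ) + 1) * lerchPhi l (-(k : ℂ)) (a - t)) *
            t ^ (p - 1 - k)) -
          (deriv (fun s : ℂ => lerchPhi l s a) (1 - (p : ℂ)) +
            Complex.digamma (p : ℂ) * lerchPhi l (1 - (p : ℂ)) a))) ∧
    HasSum (fun n : ℕ => lerchPhi l ((n : ℂ) + 1) a * t ^ n) (lerchPhi l 1 (a - t)) := by
  refine ⟨fun p hp => ?_, hasSum_lerchPhi_one_sub hl hl1 ht⟩
  obtain ⟨q, rfl⟩ : ∃ q, p = q + 1 := ⟨p - 1, by omega⟩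
  have h := hasSum_mul_pow_div_of_hasDerivAt (q := q) (c := fun n => lerchPhi l ((n : ℂ) + 1) a)
    (R := fun t => (∑ k ∈ Finset.range (q + 1), (q.choose k : ℂ) * lerchPhiDigamma l k (a - t) *
      t ^ (q - k)) - lerchPhiDigamma l q a)
    (fun t ht => hasSum_lerchPhi_one_sub hl hl1 ht)
    (fun t ht => ?_) ?_ ht
  · have e : (1 : ℂ) - ((q + 1 : ℕ) : ℂ) = -(q : ℂ) := by push_cast; ring
    rw [e, Nat.cast_succ]
    simpa only [lerchPhiDigamma, Nat.add_sub_cancel, Nat.cast_succ] using h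
  -- The inner function `a - t` flips signs, producing `c = Φ(l, 1, a - t)` and the factor `-(k +
  -- 1)`.
  · refine HasDerivAt.sub_const _ (sum_choose_mul_pow_hasDerivAt
      (h := fun k t => lerchPhiDigamma l k (a - t)) ?_ (fun k => ?_) q)
    · simpa using (lerchPhiDigamma_zero_hasDerivAt hl hl1 (re_sub_pos ht)).comp_const_sub a t
    · simpa only [neg_mul] using
        (lerchPhiDigamma_succ_hasDerivAt hl hl1 k (re_sub_pos ht)).comp_const_sub a t
  -- At `t = 0` only `k = q` survives, through `0 ^ 0 = 1`, and it cancels the subtracted constant.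
  · show _ - _ = _
    rw [Finset.sum_range_succ, Finset.sum_eq_zero fun k hk => ?_]
    · simp
    · have : q - k ≠ 0 := by have := Finset.mem_range.1 hk; omega
      rw [zero_pow this, mul_zero]
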